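/- All graphs are finite and simple. Let $L$ be a set of integers, each at least $3$. A graph $G$ is an $L$-cycle graph if the length of every cycle of $G$ belongs to $L$. A block of $G$ is a maximal connected subgraph without a cutvertex; a $2$-connected block is a block with at least three vertices. For $r\ge 1$ the theta graph $T_{r,\ell}$ is the graph that consists of $r$ paths of length $\ell$ joining two vertices $u\ne v$, any two of which have only $u$ and $v$ in common. For $\ell\ge 2$ and $2k+1>2\ell$, the class $\mathcal{C}(2k+1,2\ell)$ consists of the graphs obtained as follows: take a cycle of length $2k+1$ with vertices $1,2,\dots,2k+1$ in cyclic order, choose $s\ge 0$ vertices $i_1<\dots<i_s$ that are pairwise at distance at least $\ell$ on the cycle, and for each $j$ add an arbitrary number of paths of length $\ell$ from $i_j$ to $i_j+\ell$ (modulo $2k+1$), where the $\ell-1$ inner vertices of each added path are new vertices. Then the following hold. (a) Let $L$ be a set of odd integers, each at least $3$. If $G$ is an $L$-cycle graph, then each $2$-connected block of $G$ is a cycle with length in $L$. (b) Let $k\ge 2$ and let $G$ be a $\{2k\}$-cycle graph. Then every $2$-connected block of $G$ is a $T_{r,k}$ for some $r\ge 2$. (c) Let $\ell\ge 2$ and $2k+1>2\ell$,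 and let $G$ be a $\{2k+1,2\ell\}$-cycle graph. Then every $2$-connected block of $G$ is a $T_{r,\ell}$ for some $r\ge 2$ or a graph in $\mathcal{C}(2k+1,2\ell)$. -/

import Mathlib

/-- `G` is an `L`-cycle graph: every cycle of `G` has its length in `L`. -/
def IsLCycleGraph {V : Type*} (G : SimpleGraph V) (L : Set ℕ) : Prop :=
  ∀ (v : V) (c : G.Walk v v), c.IsCycle → c.length ∈ L

/-- `v` is a cutvertex of `G`: two vertices other than `v` lie in the same component of `G`
but in different components of `G - v`. -/
def IsCutvertex {V : Type*} (G : SimpleGraph V) (v : V) : Prop :=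
  ∃ x y : ({v}ᶜ : Set V), G.Reachable (x : V) (y : V) ∧ ¬ (G.induce {v}ᶜ).Reachable x y

/-- A block of `G`: a maximal connected subgraph without a cutvertex (of its own). -/
def IsBlock {V : Type*} {G : SimpleGraph V} (B : G.Subgraph) : Prop :=
  Maximal (fun H : G.Subgraph => H.coe.Connected ∧ ∀ v, ¬ IsCutvertex H.coe v) B

/-- A graph is 2-connected if it has at least three vertices, is connected and has no
cutvertex. -/
def IsTwoConnected {V : Type*} (G : SimpleGraph V) : Prop :=
  3 ≤ ENat.card V ∧ G.Connected ∧ ∀ v, ¬ IsCutvertex G v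

/-- A 2-connected block, i.e. a block that is neither a single vertex nor a single edge. -/
def IsTwoConnectedBlock {V : Type*} {G : SimpleGraph V} (B : G.Subgraph) : Prop :=
  IsBlock B ∧ IsTwoConnected B.coe

/-- The graph `B` is a cycle of length `m`. -/
def IsCycleOfLength {V : Type*} {G : SimpleGraph V} (B : G.Subgraph) (m : ℕ) : Prop :=
  ∃ (v : V) (c : G.Walk v v), c.IsCycle ∧ c.length = m ∧ B = c.toSubgraph

/-- The graph `B` is a theta graph `T_{r,ℓ}`: it consists of `r` distinct paths of length `ℓ`
joining two vertices `u` and `v`, any two of which meet only in `u` and `v`. -/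
def IsTheta {V : Type*} {G : SimpleGraph V} (B : G.Subgraph) (r ℓ : ℕ) : Prop :=
  ∃ (u v : V) (p : Fin r → G.Walk u v),
    u ≠ v ∧
    (∀ a, (p a).IsPath ∧ (p a).length = ℓ) ∧
    Function.Injective p ∧
    (∀ a b, a ≠ b → ∀ x, x ∈ (p a).support → x ∈ (p b).support → x = u ∨ x = v) ∧
    B = ⨆ a, (p a).toSubgraph

/-- The graph `B` arises from a cycle `c` of length `m` as follows. The vertices of the cycle are
`c.getVert 0, …, c.getVert (m - 1)` in cyclic order. Take a set `s` of positions on the cycle, any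
two of them at distance at least `ℓ` along the cycle in both directions. For each `i ∈ s`, add an
arbitrary number `r i` of paths of length `ℓ` from the vertex in position `i` to the one in
position `i + ℓ` (modulo `m`). The inner vertices of each added path are new: they lie neither on
the cycle nor on another added path. Intended for `2 ≤ ℓ` and `2 * ℓ < m`; the cycles of such a
graph have lengths `m` and `2 * ℓ` only. -/
def IsCycleWithThetas {V : Type*} {G : SimpleGraph V} (B : G.Subgraph) (m ℓ : ℕ) : Prop :=
  ∃ (v : V) (c : G.Walk v v) (s : Finset ℕ) (r : s → ℕ)
    (p : ∀ i : s, Fin (r i) → G.Walk (c.getVert i) (c.getVert ((i + ℓ) % m))),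
    c.IsCycle ∧ c.length = m ∧
    (∀ i ∈ s, i < m) ∧
    (∀ i ∈ s, ∀ j ∈ s, i < j → i + ℓ ≤ j ∧ j + ℓ ≤ i + m) ∧
    (∀ i a, (p i a).IsPath ∧ (p i a).length = ℓ) ∧
    (∀ i a x, x ∈ (p i a).support → x ∈ c.support →
      x = c.getVert i ∨ x = c.getVert ((i + ℓ) % m)) ∧
    (∀ i a j b, (⟨i, a⟩ : Σ i : s, Fin (r i)) ≠ ⟨j, b⟩ →
      ∀ x, x ∈ (p i a).support → x ∈ (p j b).support → x ∈ c.support) ∧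
    B = c.toSubgraph ⊔ ⨆ i, ⨆ a, (p i a).toSubgraph

/-!
Fix a cycle `c` of the 2-connected graph. Every edge outside `c` lies on an ear of `c`: a path that
meets `c` in its two ends only. The ear makes a cycle with each of the two arcs of `c` between its
ends, so two cycle lengths are controlled by the length of the ear.

If `c` is odd, one of these two cycles is even; hence a graph with odd cycles only is a cycle.

Suppose `c` has length `2ℓ`, or odd length greater than `2ℓ`, and all cycles have length `|c|` or
`2ℓ`. The two lengths force every ear to have length `ℓ` and to cut off an arc of length `ℓ`. Two
ears with different ends do not meet outside `c`: otherwise three disjoint paths would lead from a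
vertex outside `c` to `c`, any two of them would form an ear, so `ℓ` would be even and, by the
distances of the three ends, `|c| = 3ℓ`. Two disjoint ears with interleaved ends would make, with
two arcs of `c`, a cycle of even length greater than `2ℓ`, so the arcs cut off by the ears share at
most their ends. For `|c| = 2ℓ` this leaves a single pair of opposite vertices as ends, and for odd
`|c|` it is the condition in the definition of `𝒞(|c|, 2ℓ)`.
-/

section Paths

open SimpleGraph Walk

variable {V : Type*} {G : SimpleGraph V} {u v w x y : V}

theorem isPath_append {p : G.Walk u v} {q : G.Walk v w} (hp : p.IsPath) (hq : q.IsPath)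
    (hpq : ∀ x ∈ p.support, x ∈ q.support → x = v) : (p.append q).IsPath := by
  rw [isPath_def, support_append, List.nodup_append']
  refine ⟨hp.support_nodup, hq.support_nodup.tail, fun x hxp hxq ↦ ?_⟩
  obtain rfl := hpq x hxp (List.mem_of_mem_tail hxq)
  exact (List.nodup_cons.mp (q.cons_tail_support ▸ hq.support_nodup)).1 hxq

theorem eq_of_isPath_append {p : G.Walk u v} {q : G.Walk v w} (h : (p.append q).IsPath)
    (hp : x ∈ p.support) (hq : x ∈ q.support) : x = v := by
  by_contra hne
  exact h.ne_of_mem_support_of_append hne hp hq rfl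

theorem isCycle_append_reverse {p q : G.Walk u v} (hp : p.IsPath) (hq : q.IsPath) (huv : u ≠ v)
    (hpq : p ≠ q) (h : ∀ x ∈ p.support, x ∈ q.support → x = u ∨ x = v) :
    (p.append q.reverse).IsCycle := by
  have notMem_tail {a b : V} {r : G.Walk a b} (hr : r.IsPath) : a ∉ r.support.tail :=
    (List.nodup_cons.mp (r.cons_tail_support ▸ hr.support_nodup)).1
  refine hp.isCycle_append hq.reverse (fun x hxp hxq ↦ ?_) ?_
  · rcases h x (List.mem_of_mem_tail hxp)
      (by simpa using List.mem_of_mem_tail hxq) with rfl | rfl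
    exacts [notMem_tail hp hxp, notMem_tail hq.reverse hxq]
  · by_contra! hlen
    have hp₀ : p.length ≠ 0 := fun h₀ ↦ huv (eq_of_length_eq_zero h₀)
    have hq₀ : q.length ≠ 0 := fun h₀ ↦ huv (eq_of_length_eq_zero h₀)
    rw [length_reverse] at hlen
    exact hpq (eq_of_length_le_one (by omega) (by omega))

theorem isCycle_append_append_reverse {p : G.Walk u x} {p' : G.Walk x v} {q : G.Walk u y}
    {q' : G.Walk y v} (hp : p.IsPath) (hp' : p'.IsPath) (hq : q.IsPath) (hq' : q'.IsPath)
    (hpp' : ∀ w ∈ p.support, w ∈ p'.support → w = x)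
    (hqq' : ∀ w ∈ q.support, w ∈ q'.support → w = y)
    (hpq : ∀ w ∈ p.support, w ∈ q.support → w = u)
    (hpq' : ∀ w ∈ p'.support, w ∈ q'.support → w = v)
    (hpq'_disj : ∀ w ∈ p.support, w ∉ q'.support) (hp'q_disj : ∀ w ∈ p'.support, w ∉ q.support) :
    ((p.append p').append (q.append q').reverse).IsCycle := by
  refine isCycle_append_reverse (isPath_append hp hp' hpp') (isPath_append hq hq' hqq') ?_ ?_ ?_
  · rintro rfl
    exact hpq'_disj u p.start_mem_support q'.end_mem_support
  · intro h
    have hx : x ∈ (q.append q').support := by simp [← h]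
    rcases (mem_support_append_iff _ _).mp hx with hx | hx
    exacts [hp'q_disj x p'.start_mem_support hx, hpq'_disj x p.end_mem_support hx]
  · intro w hwp hwq
    rcases (mem_support_append_iff _ _).mp hwp with hwp | hwp <;>
      rcases (mem_support_append_iff _ _).mp hwq with hwq | hwq
    exacts [.inl (hpq w hwp hwq), absurd hwq (hpq'_disj w hwp), absurd hwq (hp'q_disj w hwp),
      .inr (hpq' w hwp hwq)]

theorem eq_or_eq_of_mem_support_of_length_le {ℓ : ℕ} (hG : (2 * ℓ : ℕ) ≤ G.egirth)
    {p q : G.Walk u v} (hp : p.IsPath) (hq : q.IsPath) (hpl : p.length ≤ ℓ) (hql : q.length ≤ ℓ)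
    (hpq : p ≠ q) (hxp : x ∈ p.support) (hxq : x ∈ q.support) : x = u ∨ x = v := by
  obtain ⟨p₁, p₂, hp₁, hp₂, rfl⟩ := hp.mem_support_iff_exists_append.mp hxp
  obtain ⟨q₁, q₂, hq₁, hq₂, rfl⟩ := hq.mem_support_iff_exists_append.mp hxq
  by_contra! hx
  have eq_of_short {a b : V} {r s : G.Walk a b} (hr : r.IsPath) (hs : s.IsPath)
      (hrs : r.length + s.length < 2 * ℓ) : r = s := by
    by_contra hne
    obtain ⟨w, -, -, c, hc, hcl⟩ := hr.exists_isCycle_length_le_add_of_ne hs hne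
    have := Nat.cast_le.mp (hG.trans (egirth_le_length hc))
    omega
  have length_pos {a b : V} (r : G.Walk a b) (hab : a ≠ b) : r.length ≠ 0 :=
    fun h ↦ hab (eq_of_length_eq_zero h)
  have hp₁' := length_pos p₁ hx.1.symm
  have hp₂' := length_pos p₂ hx.2
  have hq₁' := length_pos q₁ hx.1.symm
  have hq₂' := length_pos q₂ hx.2
  rw [length_append] at hpl hql
  exact hpq (congrArg₂ append (eq_of_short hp₁ hq₁ (by omega)) (eq_of_short hp₂ hq₂ (by omega)))

/-- The walk `p` is a path ending in `S` with no other vertex in `S`. For a subgraph with vertex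
set `S`, ears are built from such paths. -/
structure IsPathTo (S : Set V) (p : G.Walk x y) : Prop where
  isPath : p.IsPath
  end_mem : y ∈ S
  eq_end : ∀ w ∈ p.support, w ∈ S → w = y

theorem exists_isPathTo {S : Set V} (p : G.Walk x y) (hy : y ∈ S) :
    ∃ z, ∃ q : G.Walk x z, IsPathTo S q ∧ q.support ⊆ p.support := by
  classical
  suffices ∃ z ∈ S, ∃ q : G.Walk x z, (∀ w ∈ q.support, w ∈ S → w = z) ∧
      q.support ⊆ p.support by
    obtain ⟨z, hz, q, hqS, hqp⟩ := this
    exact ⟨z, q.bypass, ⟨q.bypass_isPath, hz,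
      fun w hw ↦ hqS w (q.support_bypass_subset_support hw)⟩,
      fun w hw ↦ hqp (q.support_bypass_subset_support hw)⟩
  induction p with
  | nil => exact ⟨_, hy, nil, by simp, by simp⟩
  | @cons a b d hab p ih =>
    by_cases ha : a ∈ S
    · exact ⟨a, ha, nil, by simp, by simp⟩
    · obtain ⟨z, hz, q, hqS, hqp⟩ := ih hy
      refine ⟨z, hz, cons hab q, fun w hw hwS ↦ ?_, List.cons_subset_cons _ hqp⟩
      rcases List.mem_cons.mp (q.support_cons hab ▸ hw) with rfl | hw
      exacts [absurd hwS ha, hqS w hw hwS]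

end Paths

section Ears

open SimpleGraph Walk

variable {V : Type*} {G : SimpleGraph V} {u v w x y z : V}

theorem IsTwoConnected.exists_adj (hG : IsTwoConnected G) (x : V) : ∃ y, G.Adj x y := by
  have : Nontrivial V := (ENat.one_lt_card_iff_nontrivial V).mp (lt_of_lt_of_le (by norm_num) hG.1)
  exact hG.2.1.preconnected.exists_adj_of_nontrivial x

theorem IsTwoConnected.eq_top_of_adj (hG : IsTwoConnected G) {H : G.Subgraph}
    (h : ∀ x y, G.Adj x y → H.Adj x y) : H = ⊤ := by
  refine top_le_iff.mp ⟨fun x _ ↦ ?_, fun x y hxy ↦ h x y hxy⟩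
  obtain ⟨y, hxy⟩ := hG.exists_adj x
  exact H.edge_vert (h x y hxy)

theorem IsTwoConnected.exists_walk_notMem_support (hG : IsTwoConnected G) (hyx : y ≠ x)
    (hzx : z ≠ x) : ∃ p : G.Walk y z, x ∉ p.support := by
  obtain ⟨p⟩ : (G.induce {x}ᶜ).Reachable ⟨y, hyx⟩ ⟨z, hzx⟩ := by
    by_contra h
    exact hG.2.2 x ⟨⟨y, hyx⟩, ⟨z, hzx⟩, hG.2.1.preconnected y z, h⟩
  refine ⟨p.map (Embedding.induce _).toHom, fun hx ↦ ?_⟩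
  obtain ⟨⟨w, hw⟩, -, hwx⟩ := List.mem_map.mp (support_map _ p ▸ hx)
  exact hw hwx

theorem IsTwoConnected.exists_isCycle (hG : IsTwoConnected G) :
    ∃ (v : V) (c : G.Walk v v), c.IsCycle := by
  obtain ⟨a⟩ := hG.2.1.nonempty
  obtain ⟨b, hab⟩ := hG.exists_adj a
  obtain ⟨d, hd⟩ : ∃ d, d ∉ ({a, b} : Set V) := by
    by_contra! h
    have h₂ : ENat.card V ≤ 2 := by
      rw [← Set.encard_univ, ← Set.eq_univ_of_forall h]
      exact (Set.encard_pair hab.ne).le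
    exact absurd (hG.1.trans h₂) (by norm_num)
  obtain ⟨p⟩ := hG.2.1.preconnected a d
  obtain ⟨⟨⟨x, y⟩, hxy⟩, -, hx, hy⟩ := p.exists_boundary_dart {a, b} (by simp) hd
  obtain ⟨z, hz, hxz⟩ : ∃ z ∈ ({a, b} : Set V), G.Adj x z := by
    rcases hx with rfl | rfl
    exacts [⟨b, by simp, hab⟩, ⟨a, by simp, hab.symm⟩]
  obtain ⟨q, hq⟩ := hG.exists_walk_notMem_support hxy.ne' hxz.ne'
  classical
  have hq' : x ∉ q.bypass.support := fun h ↦ hq (q.support_bypass_subset_support h)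
  refine ⟨x, cons hxy (q.bypass.concat hxz.symm), ?_⟩
  rw [cons_isCycle_iff, concat_isPath_iff]
  refine ⟨⟨q.bypass_isPath, hq'⟩, fun h ↦ ?_⟩
  rw [edges_concat, List.concat_eq_append, List.mem_append, List.mem_singleton] at h
  rcases h with h | h
  · exact hq' (q.bypass.fst_mem_support_of_mem_edges h)
  · have hyz : x = z ∧ y = x ∨ y = z := by simpa using h
    exact hy (hyz.resolve_left (fun h ↦ hxy.ne' h.2) ▸ hz)

/-- The walk `q` is an ear of the subgraph `H`: a path joining two vertices of `H` that has no
inner vertex in `H`. An edge outside `H` is required, so that an edge of `H` is not an ear. -/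
structure IsEar (H : G.Subgraph) (q : G.Walk x y) : Prop where
  isPath : q.IsPath
  ne : x ≠ y
  start_mem : x ∈ H.verts
  end_mem : y ∈ H.verts
  eq_or_eq : ∀ w ∈ q.support, w ∈ H.verts → w = x ∨ w = y
  exists_edge : ∃ e ∈ q.edges, e ∉ H.edgeSet

variable {H : G.Subgraph}

theorem IsEar.reverse {q : G.Walk x y} (hq : IsEar H q) : IsEar H q.reverse where
  isPath := hq.isPath.reverse
  ne := hq.ne.symm
  start_mem := hq.end_mem
  end_mem := hq.start_mem
  eq_or_eq w hw hwH := (hq.eq_or_eq w (by simpa using hw) hwH).symm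
  exists_edge := by simpa using hq.exists_edge

theorem IsPathTo.isEar_reverse_append {A : G.Walk z x} {B : G.Walk z y} (hA : IsPathTo H.verts A)
    (hB : IsPathTo H.verts B) (hz : z ∉ H.verts) (hAB : ∀ w ∈ A.support, w ∈ B.support → w = z) :
    IsEar H (A.reverse.append B) where
  isPath := isPath_append hA.isPath.reverse hB.isPath fun w hwA ↦ hAB w (by simpa using hwA)
  ne := by
    rintro rfl
    exact hz (hAB x A.end_mem_support B.end_mem_support ▸ hA.end_mem)
  start_mem := hA.end_mem
  end_mem := hB.end_mem
  eq_or_eq w hw hwH := by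
    rw [mem_support_append_iff, support_reverse, List.mem_reverse] at hw
    exact hw.imp (hA.eq_end w · hwH) (hB.eq_end w · hwH)
  exists_edge := by
    cases B with
    | nil => exact absurd hB.end_mem hz
    | @cons _ b _ h B => exact ⟨s(z, b), by simp, fun h ↦ hz (H.edge_vert h)⟩

theorem IsEar.exists_isPathTo {q : G.Walk x y} (hq : IsEar H q) (hzq : z ∈ q.support)
    (hz : z ∉ H.verts) : ∃ (A : G.Walk z x) (B : G.Walk z y), IsPathTo H.verts A ∧
      IsPathTo H.verts B ∧ (∀ w ∈ A.support, w ∈ B.support → w = z) ∧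
      q = A.reverse.append B := by
  obtain ⟨A, B, hA, hB, rfl⟩ := hq.isPath.mem_support_iff_exists_append.mp hzq
  have eq_of_mem (w : V) (hwA : w ∈ A.support) (hwB : w ∈ B.support) : w = z :=
    eq_of_isPath_append hq.isPath hwA hwB
  refine ⟨A.reverse, B, ⟨hA.reverse, hq.start_mem, fun w hw hwH ↦ ?_⟩,
    ⟨hB, hq.end_mem, fun w hw hwH ↦ ?_⟩, fun w hw ↦ eq_of_mem w (by simpa using hw), by simp⟩
  · rw [support_reverse, List.mem_reverse] at hw
    refine (hq.eq_or_eq w (by simp [hw]) hwH).resolve_right ?_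
    rintro rfl
    exact hz (eq_of_mem w hw B.end_mem_support ▸ hwH)
  · refine (hq.eq_or_eq w (by simp [hw]) hwH).resolve_left ?_
    rintro rfl
    exact hz (eq_of_mem w A.start_mem_support hw ▸ hwH)

theorem IsTwoConnected.exists_isEar_of_adj_of_mem (hG : IsTwoConnected G) (hH : H.verts.Nontrivial)
    (hx : x ∈ H.verts) (hxy : G.Adj x y) (hxyH : ¬ H.Adj x y) :
    ∃ (a b : V) (q : G.Walk a b), IsEar H q ∧ s(x, y) ∈ q.edges := by
  obtain ⟨h, hh, hhx⟩ := hH.exists_ne x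
  obtain ⟨p, hp⟩ := hG.exists_walk_notMem_support hxy.ne' hhx
  obtain ⟨z, q, hq, hqp⟩ := exists_isPathTo p hh
  have hxq : x ∉ q.support := fun h ↦ hp (hqp h)
  refine ⟨x, z, cons hxy q, ⟨hq.isPath.cons hxq, ?_, hx, hq.end_mem, fun w hw hwH ↦ ?_, ?_⟩,
    by simp⟩
  · rintro rfl
    exact hxq q.end_mem_support
  · exact (List.mem_cons.mp (q.support_cons hxy ▸ hw)).imp_right (hq.eq_end w · hwH)
  · exact ⟨s(x, y), by simp, hxyH⟩

theorem IsPathTo.isEar_reverse_append_cons {P : G.Walk x z} {D : G.Walk y w}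
    (hP : IsPathTo H.verts P) (hD : IsPathTo H.verts D) (hx : x ∉ H.verts) (hxD : x ∉ D.support)
    (hxy : G.Adj x y) (hPD : ∀ v ∈ P.support, v ∉ D.support) :
    IsEar H (P.reverse.append (cons hxy D)) := by
  refine hP.isEar_reverse_append ⟨hD.isPath.cons hxD, hD.end_mem, fun v hv hvH ↦ ?_⟩ hx ?_
  · rcases List.mem_cons.mp (D.support_cons hxy ▸ hv) with rfl | hv
    exacts [absurd hvH hx, hD.eq_end v hv hvH]
  · intro v hvP hv
    exact (List.mem_cons.mp (D.support_cons hxy ▸ hv)).resolve_right (hPD v hvP)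

theorem IsPathTo.exists_isEar_cons_append {a b : V} {P : G.Walk x a} {Q : G.Walk x b}
    {R : G.Walk y z} (hP : IsPathTo H.verts P) (hQ : IsPathTo H.verts Q)
    (hPQ : ∀ v ∈ P.support, v ∈ Q.support → v = x) (hx : x ∉ H.verts)
    (hR : IsPathTo ({v | v ∈ P.support ∨ v ∈ Q.support} ∪ H.verts) R) (hxR : x ∉ R.support)
    (hz : z ∈ P.support) (hxy : G.Adj x y) :
    ∃ (a b : V) (q : G.Walk a b), IsEar H q ∧ s(x, y) ∈ q.edges := by
  have hzx : z ≠ x := fun h ↦ hxR (h ▸ R.end_mem_support)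
  obtain ⟨P₁, P₂, hP₁, hP₂, rfl⟩ := hP.isPath.mem_support_iff_exists_append.mp hz
  have hxP₂ : x ∉ P₂.support := fun h ↦
    hzx (eq_of_isPath_append hP.isPath P₁.start_mem_support h).symm
  have hD : IsPathTo H.verts (R.append P₂) := by
    refine ⟨isPath_append hR.isPath hP₂ fun w hwR hwP ↦
      hR.eq_end w hwR (.inl (.inl (by simp [hwP]))), hP.end_mem, fun w hw hwH ↦ ?_⟩
    rcases (mem_support_append_iff _ _).mp hw with hw | hw
    · exact hP.eq_end w (hR.eq_end w hw (.inr hwH) ▸ hz) hwH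
    · exact hP.eq_end w (by simp [hw]) hwH
  refine ⟨_, _, _, hQ.isEar_reverse_append_cons hD hx (by simp [hxR, hxP₂]) hxy ?_, by simp⟩
  intro v hvQ hv
  rcases (mem_support_append_iff _ _).mp hv with hv | hv
  · obtain rfl := hR.eq_end v hv (.inl (.inr hvQ))
    exact hzx (hPQ v hz hvQ)
  · exact hxP₂ (hPQ v (by simp [hv]) hvQ ▸ hv)

theorem IsTwoConnected.exists_isEar_of_adj_of_isEar (hG : IsTwoConnected G) {a b : V}
    {q : G.Walk a b} (hq : IsEar H q) (hxq : x ∈ q.support) (hx : x ∉ H.verts) (hxy : G.Adj x y) :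
    ∃ (a b : V) (q : G.Walk a b), IsEar H q ∧ s(x, y) ∈ q.edges := by
  obtain ⟨A, B, hA, hB, hAB, -⟩ := hq.exists_isPathTo hxq hx
  have hax : a ≠ x := fun h ↦ hx (h ▸ hq.start_mem)
  obtain ⟨p, hp⟩ := hG.exists_walk_notMem_support hxy.ne' hax
  obtain ⟨z, R, hR, hRp⟩ := _root_.exists_isPathTo
    (S := {v | v ∈ A.support ∨ v ∈ B.support} ∪ H.verts) p (.inr hq.start_mem)
  have hxR : x ∉ R.support := fun h ↦ hp (hRp h)
  by_cases hzA : z ∈ A.support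
  · exact hA.exists_isEar_cons_append hB hAB hx hR hxR hzA hxy
  by_cases hzB : z ∈ B.support
  · simp only [or_comm (a := _ ∈ A.support)] at hR
    exact hB.exists_isEar_cons_append hA (fun v hvB hvA ↦ hAB v hvA hvB) hx hR hxR hzB hxy
  · have hzH : z ∈ H.verts := hR.end_mem.resolve_left (not_or.mpr ⟨hzA, hzB⟩)
    refine ⟨_, _, _, hA.isEar_reverse_append_cons
      ⟨hR.isPath, hzH, fun w hw hwH ↦ hR.eq_end w hw (.inr hwH)⟩ hx hxR hxy ?_, by simp⟩
    exact fun v hvA hvR ↦ hzA (hR.eq_end v hvR (.inl (.inl hvA)) ▸ hvA)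

theorem IsTwoConnected.exists_isEar_of_adj (hG : IsTwoConnected G) (hH : H.verts.Nontrivial)
    (hxy : G.Adj x y) (hxyH : ¬ H.Adj x y) :
    ∃ (a b : V) (q : G.Walk a b), IsEar H q ∧ s(x, y) ∈ q.edges := by
  suffices covered : x ∈ H.verts ∨ ∃ (a b : V) (q : G.Walk a b), IsEar H q ∧ x ∈ q.support by
    by_cases hx : x ∈ H.verts
    · exact hG.exists_isEar_of_adj_of_mem hH hx hxy hxyH
    · obtain ⟨a, b, q, hq, hxq⟩ := covered.resolve_left hx
      exact hG.exists_isEar_of_adj_of_isEar hq hxq hx hxy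
  obtain ⟨h, hh⟩ := hH.nonempty
  obtain ⟨p⟩ := hG.2.1.preconnected x h
  clear hxy hxyH
  induction p with
  | nil => exact .inl hh
  | @cons x z _ hxz _ ih =>
    by_cases hxzH : H.Adj x z
    · exact .inl (H.edge_vert hxzH)
    have ⟨a, b, q, hq, hzxq⟩ : ∃ (a b : V) (q : G.Walk a b), IsEar H q ∧ s(z, x) ∈ q.edges := by
      by_cases hz : z ∈ H.verts
      · exact hG.exists_isEar_of_adj_of_mem hH hz hxz.symm (fun h ↦ hxzH h.symm)
      · obtain ⟨a, b, q, hq, hzq⟩ := (ih hh).resolve_left hz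
        exact hG.exists_isEar_of_adj_of_isEar hq hzq hz hxz.symm
    exact .inr ⟨a, b, q, hq, q.snd_mem_support_of_mem_edges hzxq⟩

end Ears

section Cycles

open SimpleGraph Walk

variable {V : Type*} {G : SimpleGraph V} {v x y : V} {c : G.Walk v v} {i j n d : ℕ}

/-- The vertex in position `n` of the closed walk `c`, with positions read modulo `c.length`. -/
def cycVert (c : G.Walk v v) (n : ℕ) : V :=
  c.getVert (n % c.length)

theorem cycVert_congr (h : i ≡ j [MOD c.length]) : cycVert c i = cycVert c j :=
  congrArg c.getVert h

theorem cycVert_of_lt (h : i < c.length) : cycVert c i = c.getVert i :=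
  congrArg c.getVert (Nat.mod_eq_of_lt h)

theorem cycVert_add_length (c : G.Walk v v) (n : ℕ) : cycVert c (n + c.length) = cycVert c n :=
  cycVert_congr (Nat.add_mod_right n c.length)

theorem getVert_eq_cycVert (h : i ≤ c.length) : c.getVert i = cycVert c i := by
  rcases h.lt_or_eq with h | rfl
  · exact (cycVert_of_lt h).symm
  · simp [cycVert]

theorem cycVert_eq_iff (hc : c.IsCycle) : cycVert c i = cycVert c j ↔ i ≡ j [MOD c.length] := by
  have := hc.three_le_length
  have mem (n : ℕ) : n % c.length ∈ {n | n ≤ c.length - 1} :=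
    Nat.le_sub_one_of_lt (Nat.mod_lt n (by omega))
  exact hc.getVert_injOn'.eq_iff (mem i) (mem j)

theorem eq_of_cycVert_add_eq (hc : c.IsCycle) (hi : i < c.length) (hj : j < c.length)
    (h : cycVert c (n + i) = cycVert c (n + j)) : i = j :=
  (((cycVert_eq_iff hc).mp h).add_left_cancel' n).eq_of_lt_of_lt hi hj

theorem exists_lt_modEq_add {m : ℕ} (hm : 0 < m) (i j : ℕ) : ∃ d < m, j ≡ i + d [MOD m] := by
  refine ⟨(j + i * (m - 1)) % m, Nat.mod_lt _ hm, Nat.ModEq.symm ?_⟩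
  calc i + (j + i * (m - 1)) % m ≡ i + (j + i * (m - 1)) [MOD m] :=
        (Nat.mod_modEq _ _).add_left i
    _ = j + i * m := by
        obtain ⟨m, rfl⟩ := Nat.exists_eq_add_of_lt hm
        simp only [zero_add, Nat.add_sub_cancel]
        ring
    _ ≡ j [MOD m] := by simp [Nat.ModEq]

theorem exists_eq_cycVert_add (hc : c.IsCycle) (hx : x ∈ c.support) (i : ℕ) :
    ∃ d < c.length, x = cycVert c (i + d) := by
  obtain ⟨n, rfl, hn⟩ := mem_support_iff_exists_getVert.mp hx
  obtain ⟨d, hd, h⟩ := exists_lt_modEq_add (Nat.zero_lt_of_lt hc.three_le_length) i n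
  exact ⟨d, hd, (getVert_eq_cycVert hn).trans (cycVert_congr h)⟩

theorem cycVert_mem_support (c : G.Walk v v) (n : ℕ) : cycVert c n ∈ c.support :=
  c.getVert_mem_support _

theorem mk_cycVert_mem_edges (hc : c.IsCycle) (n : ℕ) :
    s(cycVert c n, cycVert c (n + 1)) ∈ c.edges := by
  have hn : n % c.length < c.length := Nat.mod_lt n (Nat.zero_lt_of_lt hc.three_le_length)
  refine (c.mk_mem_edges_iff_exists).mpr ⟨n % c.length, hn, ?_⟩
  rw [getVert_eq_cycVert hn, cycVert_congr ((Nat.mod_modEq n c.length).add_right 1)]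
  rfl

theorem exists_eq_mk_cycVert_add {e : Sym2 V} (he : e ∈ c.edges) (i : ℕ) :
    ∃ d < c.length, e = s(cycVert c (i + d), cycVert c (i + d + 1)) := by
  induction e with | _ x y
  obtain ⟨n, hn, h⟩ := (c.mk_mem_edges_iff_exists).mp he
  obtain ⟨d, hd, hnd⟩ := exists_lt_modEq_add (Nat.zero_lt_of_lt hn) i n
  refine ⟨d, hd, ?_⟩
  rw [← h, getVert_eq_cycVert hn.le, getVert_eq_cycVert (Nat.succ_le_of_lt hn), cycVert_congr hnd,
    cycVert_congr (hnd.add_right 1)]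

theorem exists_isPath_cycVert (hc : c.IsCycle) (hd : d < c.length) (hx : x = cycVert c i)
    (hy : y = cycVert c (i + d)) : ∃ p : G.Walk x y, p.IsPath ∧ p.length = d ∧
      (∀ x, x ∈ p.support ↔ ∃ k ≤ d, x = cycVert c (i + k)) ∧
      (∀ e, e ∈ p.edges ↔ ∃ k < d, e = s(cycVert c (i + k), cycVert c (i + k + 1))) := by
  subst hx hy
  induction d with
  | zero => exact ⟨nil, by simp⟩
  | succ d ih =>
    obtain ⟨p, hp, hpl, hps, hpe⟩ := ih (by omega)
    have hadj : G.Adj (cycVert c (i + d)) (cycVert c (i + d + 1)) :=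
      c.adj_of_mem_edges (mk_cycVert_mem_edges hc (i + d))
    refine ⟨p.concat hadj, ?_, by rw [length_concat, hpl], fun x ↦ ?_, fun e ↦ ?_⟩
    · rw [concat_isPath_iff]
      refine ⟨hp, fun h ↦ ?_⟩
      obtain ⟨k, hk, h⟩ := (hps _).mp h
      have := eq_of_cycVert_add_eq hc (i := d + 1) hd (by omega) h
      omega
    · simp only [support_concat, List.mem_append, hps, List.mem_singleton,
        Nat.le_succ_iff, or_and_right, exists_or, exists_eq_left]
    · simp only [edges_concat, List.concat_eq_append, List.mem_append, hpe, List.mem_singleton,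
        Nat.lt_succ_iff_lt_or_eq, or_and_right, exists_or, exists_eq_left]
      rfl

end Cycles

section CycleEars

open SimpleGraph Walk

variable {V : Type*} {G : SimpleGraph V} {v x y x' y' : V} {c : G.Walk v v} {q : G.Walk x y}
  {p : G.Walk x' y'} {i a b d k : ℕ}

theorem IsEar.exists_isCycle (hq : IsEar c.toSubgraph q) (hc : c.IsCycle) (hx : x = cycVert c i)
    (hy : y = cycVert c (i + d)) (hd : d < c.length) :
    ∃ (w : V) (c' : G.Walk w w), c'.IsCycle ∧ c'.length = q.length + d := by
  obtain ⟨p, hp, hpl, hps, hpe⟩ := exists_isPath_cycVert hc hd hx hy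
  refine ⟨_, q.append p.reverse, isCycle_append_reverse hq.isPath hp hq.ne ?_ ?_, by simp [hpl]⟩
  · rintro rfl
    obtain ⟨e, he, hec⟩ := hq.exists_edge
    obtain ⟨k, -, rfl⟩ := (hpe e).mp he
    exact hec ((mem_edges_toSubgraph c).mpr (mk_cycVert_mem_edges hc _))
  · intro w hwq hwp
    obtain ⟨k, -, rfl⟩ := (hps w).mp hwp
    exact hq.eq_or_eq _ hwq ((mem_verts_toSubgraph c).mpr (cycVert_mem_support c _))

theorem IsEar.exists_isCycle_sub (hq : IsEar c.toSubgraph q) (hc : c.IsCycle)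
    (hx : x = cycVert c i) (hy : y = cycVert c (i + d)) (hd : d < c.length) :
    ∃ (w : V) (c' : G.Walk w w), c'.IsCycle ∧ c'.length = q.length + (c.length - d) := by
  have hd₀ : d ≠ 0 := by
    rintro rfl
    exact hq.ne (hx.trans hy.symm)
  have hx' : x = cycVert c (i + d + (c.length - d)) := by
    rw [hx, Nat.add_assoc, Nat.add_sub_cancel' hd.le, cycVert_add_length]
  simpa using hq.reverse.exists_isCycle hc hy hx' (by omega)

theorem IsEar.exists_cycVert (hq : IsEar c.toSubgraph q) (hc : c.IsCycle) :
    ∃ i < c.length, ∃ d < c.length, x = cycVert c i ∧ y = cycVert c (i + d) := by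
  obtain ⟨i, hi, hx⟩ := exists_eq_cycVert_add hc ((mem_verts_toSubgraph c).mp hq.start_mem) 0
  obtain ⟨d, hd, hy⟩ := exists_eq_cycVert_add hc ((mem_verts_toSubgraph c).mp hq.end_mem) i
  exact ⟨i, hi, d, hd, by simpa using hx, hy⟩

theorem IsEar.eq_or_eq_of_cycVert_mem (hq : IsEar c.toSubgraph q) (hc : c.IsCycle)
    (hx : x = cycVert c (i + a)) (hy : y = cycVert c (i + b)) (ha : a < c.length)
    (hb : b < c.length) (hk : k < c.length) (h : cycVert c (i + k) ∈ q.support) :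
    k = a ∨ k = b :=
  (hq.eq_or_eq _ h ((mem_verts_toSubgraph c).mpr (cycVert_mem_support c _))).imp
    (fun h ↦ eq_of_cycVert_add_eq hc hk ha (h.trans hx))
    (fun h ↦ eq_of_cycVert_add_eq hc hk hb (h.trans hy))

theorem IsEar.exists_isCycle_of_crossing (hp : IsEar c.toSubgraph p) (hq : IsEar c.toSubgraph q)
    (hc : c.IsCycle) (hx' : x' = cycVert c i) (hy' : y' = cycVert c (i + a))
    (hx : x = cycVert c (i + b)) (hy : y = cycVert c (i + d)) (hba : b < a) (had : a < d)
    (hd : d < c.length) (hpq : ∀ w ∈ p.support, w ∉ q.support) :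
    ∃ (w : V) (c' : G.Walk w w), c'.IsCycle ∧
      c'.length = p.length + (d - a) + (q.length + b) := by
  have hp_mem {k : ℕ} (hk : k < c.length) (h : cycVert c (i + k) ∈ p.support) : k = 0 ∨ k = a :=
    hp.eq_or_eq_of_cycVert_mem hc hx' hy' (by omega) (by omega) hk h
  have hq_mem {k : ℕ} (hk : k < c.length) (h : cycVert c (i + k) ∈ q.support) : k = b ∨ k = d :=
    hq.eq_or_eq_of_cycVert_mem hc hx hy (by omega) hd hk h
  obtain ⟨A, hA, hAl, hAs, -⟩ := exists_isPath_cycVert hc (d := b) (by omega) hx' hx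
  obtain ⟨B, hB, hBl, hBs, -⟩ := exists_isPath_cycVert hc (d := d - a) (by omega) hy'
    (y := y) (by rw [hy, Nat.add_assoc, Nat.add_sub_cancel' had.le])
  simp only [Nat.add_assoc] at hBs
  refine ⟨x', (p.append B).append (A.append q).reverse,
    isCycle_append_append_reverse hp.isPath hB hA hq.isPath ?_ ?_ ?_ ?_ hpq ?_,
    by simp [hAl, hBl]⟩
  · intro w hwp hwB
    obtain ⟨k, hk, rfl⟩ := (hBs w).mp hwB
    rw [hy', (hp_mem (by omega) hwp).resolve_left (by omega)]
  · intro w hwA hwq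
    obtain ⟨k, hk, rfl⟩ := (hAs w).mp hwA
    rw [hx, (hq_mem (by omega) hwq).resolve_right (by omega)]
  · intro w hwp hwA
    obtain ⟨k, hk, rfl⟩ := (hAs w).mp hwA
    rw [hx', (hp_mem (by omega) hwp).resolve_right (by omega), Nat.add_zero]
  · intro w hwB hwq
    obtain ⟨k, hk, rfl⟩ := (hBs w).mp hwB
    rw [hy, (hq_mem (by omega) hwq).resolve_left (by omega)]
  · intro w hwB hwA
    obtain ⟨k, hk, rfl⟩ := (hBs w).mp hwB
    obtain ⟨k', hk', h⟩ := (hAs _).mp hwA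
    have := eq_of_cycVert_add_eq hc (by omega) (by omega) h
    omega

theorem nontrivial_verts_toSubgraph (hc : c.IsCycle) : c.toSubgraph.verts.Nontrivial := by
  have hm := hc.three_le_length
  refine ⟨cycVert c 0, (mem_verts_toSubgraph c).mpr (cycVert_mem_support c 0),
    cycVert c 1, (mem_verts_toSubgraph c).mpr (cycVert_mem_support c 1), fun h ↦ ?_⟩
  exact Nat.zero_ne_one ((cycVert_eq_iff hc |>.mp h).eq_of_lt_of_lt (by omega) (by omega))

theorem IsEar.exists_isCycle_even_length (hq : IsEar c.toSubgraph q) (hc : c.IsCycle)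
    (hodd : Odd c.length) : ∃ (w : V) (c' : G.Walk w w), c'.IsCycle ∧ Even c'.length := by
  obtain ⟨i, -, d, hd, hx, hy⟩ := hq.exists_cycVert hc
  obtain ⟨w, c₁, hc₁, h₁⟩ := hq.exists_isCycle hc hx hy hd
  obtain ⟨w', c₂, hc₂, h₂⟩ := hq.exists_isCycle_sub hc hx hy hd
  rw [Nat.odd_iff] at hodd
  rcases Nat.even_or_odd c₁.length with h | h
  · exact ⟨w, c₁, hc₁, h⟩
  · refine ⟨w', c₂, hc₂, ?_⟩
    rw [Nat.odd_iff] at h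
    rw [Nat.even_iff]
    omega

theorem IsTwoConnected.exists_isCycleOfLength_top (hG : IsTwoConnected G) {L : Set ℕ}
    (hL : ∀ m ∈ L, Odd m) (hGL : IsLCycleGraph G L) :
    ∃ m ∈ L, IsCycleOfLength (⊤ : G.Subgraph) m := by
  obtain ⟨v, c, hc⟩ := hG.exists_isCycle
  have hcL := hGL v c hc
  refine ⟨c.length, hcL, v, c, hc, rfl, (hG.eq_top_of_adj fun x y hxy ↦ ?_).symm⟩
  by_contra h
  obtain ⟨a, b, q, hq, -⟩ := hG.exists_isEar_of_adj (nontrivial_verts_toSubgraph hc) hxy h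
  obtain ⟨w, c', hc', heven⟩ := hq.exists_isCycle_even_length hc (hL _ hcL)
  exact Nat.not_odd_iff_even.mpr heven (hL _ (hGL w c' hc'))

end CycleEars

section BaseCycles

open SimpleGraph Walk

variable {V : Type*} {G : SimpleGraph V} {v x y x' y' z : V} {c : G.Walk v v} {ℓ i j d : ℕ}
  {q : G.Walk x y} {p : G.Walk x' y'}

/-- `c` is a cycle of length `2 * ℓ`, or of odd length greater than `2 * ℓ`, in a graph all of
whose cycles have length `c.length` or `2 * ℓ`. Parts (b) and (c) of the theorem are the two
cases for `c.length`. -/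
structure IsBaseCycle (c : G.Walk v v) (ℓ : ℕ) : Prop where
  isCycle : c.IsCycle
  length_eq_or : c.length = 2 * ℓ ∨ Odd c.length ∧ 2 * ℓ < c.length
  isLCycleGraph : IsLCycleGraph G {c.length, 2 * ℓ}

/-- The walk `q` is an ear of `c` from the vertex in position `i` to that in position `i + ℓ`. Up to
reversal, every ear of a base cycle is of this form. -/
structure IsEarAt (c : G.Walk v v) (ℓ i : ℕ) (q : G.Walk x y) : Prop
    extends IsEar c.toSubgraph q where
  start_eq : x = cycVert c i
  end_eq : y = cycVert c (i + ℓ)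

theorem IsEarAt.congr (hq : IsEarAt c ℓ i q) (hij : i ≡ j [MOD c.length]) : IsEarAt c ℓ j q where
  toIsEar := hq.toIsEar
  start_eq := hq.start_eq.trans (cycVert_congr hij)
  end_eq := hq.end_eq.trans (cycVert_congr (hij.add_right ℓ))

namespace IsBaseCycle

theorem two_mul_le_length (hc : IsBaseCycle c ℓ) : 2 * ℓ ≤ c.length := by
  have := hc.length_eq_or
  omega

theorem two_mul_le_egirth (hc : IsBaseCycle c ℓ) : (2 * ℓ : ℕ) ≤ G.egirth := by
  refine le_egirth.mpr fun w c' hc' ↦ Nat.cast_le.mpr ?_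
  rcases hc.isLCycleGraph w c' hc' with h | h
  exacts [h ▸ hc.two_mul_le_length, h.ge]

theorem length_ear (hc : IsBaseCycle c ℓ) (hq : IsEar c.toSubgraph q) (hx : x = cycVert c i)
    (hy : y = cycVert c (i + d)) (hd : d < c.length) :
    q.length = ℓ ∧ (d = ℓ ∨ d + ℓ = c.length) := by
  obtain ⟨_, c₁, hc₁, h₁⟩ := hq.exists_isCycle hc.isCycle hx hy hd
  obtain ⟨_, c₂, hc₂, h₂⟩ := hq.exists_isCycle_sub hc.isCycle hx hy hd
  have hc₁' : c₁.length = c.length ∨ c₁.length = 2 * ℓ := hc.isLCycleGraph _ c₁ hc₁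
  have hc₂' : c₂.length = c.length ∨ c₂.length = 2 * ℓ := hc.isLCycleGraph _ c₂ hc₂
  have h := hc.length_eq_or
  rw [Nat.odd_iff] at h
  omega

theorem length_eq_of_isEar (hc : IsBaseCycle c ℓ) (hq : IsEar c.toSubgraph q) : q.length = ℓ := by
  obtain ⟨i, -, d, hd, hx, hy⟩ := hq.exists_cycVert hc.isCycle
  exact (hc.length_ear hq hx hy hd).1

theorem exists_isEarAt_of_isEar (hc : IsBaseCycle c ℓ) (hq : IsEar c.toSubgraph q) :
    ∃ i < c.length, IsEarAt c ℓ i q ∨ IsEarAt c ℓ i q.reverse := by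
  obtain ⟨i, hi, d, hd, hx, hy⟩ := hq.exists_cycVert hc.isCycle
  rcases (hc.length_ear hq hx hy hd).2 with rfl | hdl
  · exact ⟨i, hi, .inl ⟨hq, hx, hy⟩⟩
  · refine ⟨(i + d) % c.length, Nat.mod_lt _ (by omega), .inr ?_⟩
    have hqr : IsEarAt c ℓ (i + d) q.reverse :=
      ⟨hq.reverse, hy, by rw [hx, Nat.add_assoc, hdl, cycVert_add_length]⟩
    exact hqr.congr (Nat.mod_modEq _ _).symm

theorem exists_isEarAt_of_adj (hc : IsBaseCycle c ℓ) (hG : IsTwoConnected G) {a b : V}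
    (hab : G.Adj a b) (habc : ¬ c.toSubgraph.Adj a b) :
    ∃ i < c.length, ∃ (x y : V) (q : G.Walk x y), IsEarAt c ℓ i q ∧ s(a, b) ∈ q.edges := by
  obtain ⟨x, y, q, hq, hqe⟩ :=
    hG.exists_isEar_of_adj (nontrivial_verts_toSubgraph hc.isCycle) hab habc
  obtain ⟨i, hi, hqi | hqi⟩ := hc.exists_isEarAt_of_isEar hq
  exacts [⟨i, hi, x, y, q, hqi, hqe⟩, ⟨i, hi, y, x, q.reverse, hqi, by simpa using hqe⟩]

theorem not_exists_tripod (hc : IsBaseCycle c ℓ) {a₁ a₂ a₃ : V} {A₁ : G.Walk z a₁}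
    {A₂ : G.Walk z a₂} {A₃ : G.Walk z a₃} (h₁ : IsPathTo c.toSubgraph.verts A₁)
    (h₂ : IsPathTo c.toSubgraph.verts A₂) (h₃ : IsPathTo c.toSubgraph.verts A₃)
    (hz : z ∉ c.toSubgraph.verts) (h₁₂ : ∀ w ∈ A₁.support, w ∈ A₂.support → w = z)
    (h₁₃ : ∀ w ∈ A₁.support, w ∈ A₃.support → w = z)
    (h₂₃ : ∀ w ∈ A₂.support, w ∈ A₃.support → w = z) : False := by
  have hE₁₂ := h₁.isEar_reverse_append h₂ hz h₁₂
  have hE₁₃ := h₁.isEar_reverse_append h₃ hz h₁₃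
  have hE₂₃ := h₂.isEar_reverse_append h₃ hz h₂₃
  have l₁₂ := hc.length_eq_of_isEar hE₁₂
  have l₁₃ := hc.length_eq_of_isEar hE₁₃
  have l₂₃ := hc.length_eq_of_isEar hE₂₃
  simp only [length_append, length_reverse] at l₁₂ l₁₃ l₂₃
  obtain ⟨i, -, d₂, hd₂, ha₁, ha₂⟩ := hE₁₂.exists_cycVert hc.isCycle
  obtain ⟨d₃, hd₃, ha₃⟩ := exists_eq_cycVert_add hc.isCycle
    ((mem_verts_toSubgraph c).mp h₃.end_mem) i
  have hl₂ := (hc.length_ear hE₁₂ ha₁ ha₂ hd₂).2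
  have hl₃ := (hc.length_ear hE₁₃ ha₁ ha₃ hd₃).2
  have h := hc.length_eq_or
  rw [Nat.odd_iff] at h
  rcases lt_trichotomy d₂ d₃ with hlt | rfl | hlt
  · have := (hc.length_ear hE₂₃ (d := d₃ - d₂) ha₂ (by rw [ha₃]; congr 1; omega) (by omega)).2
    omega
  · exact hE₂₃.ne (ha₂.trans ha₃.symm)
  · have := (hc.length_ear hE₂₃.reverse (d := d₂ - d₃) ha₃ (by rw [ha₂]; congr 1; omega)
      (by omega)).2
    omega

theorem end_mem_of_mem_support (hc : IsBaseCycle c ℓ) (hq : IsEar c.toSubgraph q)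
    (hp : IsEar c.toSubgraph p) (hzq : z ∈ q.support) (hzp : z ∈ p.support)
    (hz : z ∉ c.toSubgraph.verts) : x = x' ∨ x = y' := by
  by_contra! hx
  have hxp : x ∉ p.support := fun h ↦
    (hp.eq_or_eq x h hq.start_mem).elim hx.1 hx.2
  obtain ⟨A, -, hA, -, -, -⟩ := hq.exists_isPathTo hzq hz
  obtain ⟨w, R, hR, hRA⟩ := exists_isPathTo (S := {a | a ∈ p.support}) A.reverse hzp
  have hRq (a : V) (ha : a ∈ R.support) (hac : a ∈ c.toSubgraph.verts) : a = x :=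
    hA.eq_end a (by simpa using hRA ha) hac
  have hw : w ∉ c.toSubgraph.verts := fun h ↦
    hxp (hRq w R.end_mem_support h ▸ hR.end_mem)
  obtain ⟨P₁, P₂, hP₁, hP₂, hP, rfl⟩ := hp.exists_isPathTo hR.end_mem hw
  have hR' : IsPathTo c.toSubgraph.verts R.reverse :=
    ⟨hR.isPath.reverse, hq.start_mem, fun a ha ↦ hRq a (by simpa using ha)⟩
  refine hc.not_exists_tripod hP₁ hP₂ hR' hw hP ?_ ?_
  · exact fun a ha haR ↦ hR.eq_end a (by simpa using haR) (by simp [ha])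
  · exact fun a ha haR ↦ hR.eq_end a (by simpa using haR) (by simp [ha])

theorem eq_and_add_eq_of_mem_support (hc : IsBaseCycle c ℓ) (hp : IsEarAt c ℓ i p)
    (hq : IsEarAt c ℓ (i + d) q) (hd : 0 < d) (hdm : d < c.length) (hzp : z ∈ p.support)
    (hzq : z ∈ q.support) (hz : z ∉ c.toSubgraph.verts) : d = ℓ ∧ d + ℓ = c.length := by
  have hm := hc.two_mul_le_length
  have hne : cycVert c (i + 0) ≠ cycVert c (i + d) := fun h ↦
    hd.ne (eq_of_cycVert_add_eq hc.isCycle (by omega) hdm h)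
  have hx := hc.end_mem_of_mem_support hp.toIsEar hq.toIsEar hzp hzq hz
  have hx' := hc.end_mem_of_mem_support hq.toIsEar hp.toIsEar hzq hzp hz
  rw [hp.start_eq, hq.start_eq, hq.end_eq, Nat.add_assoc] at hx
  rw [hp.start_eq, hq.start_eq, hp.end_eq] at hx'
  obtain rfl := eq_of_cycVert_add_eq hc.isCycle hdm (by omega) (hx'.resolve_left hne.symm)
  refine ⟨rfl, by_contra fun hne' ↦ ?_⟩
  have := eq_of_cycVert_add_eq hc.isCycle (i := 0) (by omega) (by omega) (hx.resolve_left hne)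
  omega

theorem le_of_isEarAt_add (hc : IsBaseCycle c ℓ) (hp : IsEarAt c ℓ i p)
    (hq : IsEarAt c ℓ (i + d) q) (hd : 0 < d) : ℓ ≤ d := by
  by_contra! hdℓ
  have hm := hc.two_mul_le_length
  have hqe : y = cycVert c (i + (ℓ + d)) := by rw [hq.end_eq, Nat.add_assoc, Nat.add_comm d]
  have hpq (w : V) (hwp : w ∈ p.support) (hwq : w ∈ q.support) : False := by
    by_cases hw : w ∈ c.toSubgraph.verts
    · obtain ⟨k, hk, rfl⟩ := exists_eq_cycVert_add hc.isCycle ((mem_verts_toSubgraph c).mp hw) i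
      have := hp.eq_or_eq_of_cycVert_mem hc.isCycle (i := i) (a := 0) hp.start_eq hp.end_eq
        (by omega) (by omega) hk hwp
      have := hq.eq_or_eq_of_cycVert_mem hc.isCycle hq.start_eq hqe (by omega) (by omega) hk hwq
      omega
    · have := hc.eq_and_add_eq_of_mem_support hp hq hd (by omega) hwp hwq hw
      omega
  obtain ⟨_, c', hc', hl⟩ := hp.exists_isCycle_of_crossing hq.toIsEar hc.isCycle hp.start_eq
    hp.end_eq hq.start_eq hqe hdℓ (by omega) (by omega) hpq
  have hlen : c'.length = c.length ∨ c'.length = 2 * ℓ := hc.isLCycleGraph _ c' hc'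
  rw [hl, hc.length_eq_of_isEar hp.toIsEar, hc.length_eq_of_isEar hq.toIsEar] at hlen
  have h := hc.length_eq_or
  rw [Nat.odd_iff] at h
  omega

theorem add_le_and_add_le_of_isEarAt (hc : IsBaseCycle c ℓ) (hp : IsEarAt c ℓ i p)
    (hq : IsEarAt c ℓ j q) (hij : i < j) (hj : j < i + c.length) :
    i + ℓ ≤ j ∧ j + ℓ ≤ i + c.length := by
  obtain ⟨d, rfl⟩ := Nat.exists_eq_add_of_le hij.le
  have hp' : IsEarAt c ℓ (i + d + (c.length - d)) p := hp.congr (by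
    rw [Nat.add_assoc, Nat.add_sub_cancel' (by omega)]
    exact (Nat.add_mod_right i c.length).symm)
  have h₁ := hc.le_of_isEarAt_add hp hq (by omega)
  have h₂ := hc.le_of_isEarAt_add hq hp' (by omega)
  omega

theorem mem_support_of_isEarAt_of_lt (hc : IsBaseCycle c ℓ) (hlt : 2 * ℓ < c.length)
    (hp : IsEarAt c ℓ i p) (hq : IsEarAt c ℓ j q) (hij : i < j) (hj : j < i + c.length)
    (hzp : z ∈ p.support) (hzq : z ∈ q.support) : z ∈ c.support := by
  by_contra hz
  obtain ⟨d, rfl⟩ := Nat.exists_eq_add_of_le hij.le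
  have := hc.eq_and_add_eq_of_mem_support hp hq (by omega) (by omega) hzp hzq
    (by rwa [mem_verts_toSubgraph])
  omega

theorem mem_support_of_isEarAt {p p' : G.Walk x y} (hc : IsBaseCycle c ℓ) (hp : IsEarAt c ℓ i p)
    (hp' : IsEarAt c ℓ i p') (hpp' : p ≠ p') (hzp : z ∈ p.support) (hzp' : z ∈ p'.support) :
    z ∈ c.support := by
  rcases eq_or_eq_of_mem_support_of_length_le hc.two_mul_le_egirth hp.isPath hp'.isPath
    (hc.length_eq_of_isEar hp.toIsEar).le (hc.length_eq_of_isEar hp'.toIsEar).le hpp' hzp hzp'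
    with rfl | rfl
  exacts [(mem_verts_toSubgraph c).mp hp.start_mem, (mem_verts_toSubgraph c).mp hp.end_mem]

theorem exists_forall_isEarAt (hc : IsBaseCycle c ℓ) (h : c.length = 2 * ℓ) :
    ∃ i, ∀ j x y (q : G.Walk x y), IsEarAt c ℓ j q →
      x = cycVert c i ∧ y = cycVert c (i + ℓ) ∨ x = cycVert c (i + ℓ) ∧ y = cycVert c i := by
  by_cases hear : ∃ i x y, ∃ p : G.Walk x y, IsEarAt c ℓ i p
  · obtain ⟨i, x', y', p, hp⟩ := hear
    refine ⟨i, fun j x y q hq ↦ ?_⟩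
    have hm := hc.isCycle.three_le_length
    obtain ⟨d, hd, hj⟩ := exists_lt_modEq_add (m := c.length) (by omega) i j
    replace hq := hq.congr hj
    rcases Nat.eq_zero_or_pos d with rfl | hd₀
    · exact .inl ⟨hq.start_eq, hq.end_eq⟩
    · have := hc.add_le_and_add_le_of_isEarAt hp hq (by omega) (by omega)
      obtain rfl : d = ℓ := by omega
      refine .inr ⟨hq.start_eq, ?_⟩
      rw [hq.end_eq, Nat.add_assoc, ← Nat.two_mul, ← h, cycVert_add_length]
  · exact ⟨0, fun j x y q hq ↦ absurd ⟨j, x, y, q, hq⟩ hear⟩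

end IsBaseCycle

end BaseCycles

section Structure

open SimpleGraph Walk

variable {V : Type*} {G : SimpleGraph V} {u v : V} {c : G.Walk v v} {ℓ : ℕ}

theorem finite_subtype_of_isPath [Finite V] {P : G.Walk u v → Prop} (hP : ∀ p, P p → p.IsPath) :
    Finite {p // P p} := by
  classical
  have := Fintype.ofFinite V
  have : Finite (G.Path u v) := Finite.of_fintype _
  exact Finite.of_injective (Subtype.map id hP : {p // P p} → G.Path u v)
    (Subtype.map_injective _ Function.injective_id)

theorem IsTwoConnected.isTheta_top [Finite V] (hG : IsTwoConnected G)
    (hgirth : (2 * ℓ : ℕ) ≤ G.egirth) (huv : u ≠ v)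
    (hadj : ∀ x y, G.Adj x y → ∃ p : G.Walk u v, (p.IsPath ∧ p.length = ℓ) ∧ s(x, y) ∈ p.edges) :
    IsTheta (⊤ : G.Subgraph) (Nat.card {p : G.Walk u v // p.IsPath ∧ p.length = ℓ}) ℓ := by
  have : Finite {p : G.Walk u v // p.IsPath ∧ p.length = ℓ} :=
    finite_subtype_of_isPath fun p hp ↦ hp.1
  let e := (Finite.equivFin {p : G.Walk u v // p.IsPath ∧ p.length = ℓ}).symm
  refine ⟨u, v, fun a ↦ (e a).1, huv, fun a ↦ (e a).2,
    Subtype.val_injective.comp e.injective, fun a b hab x hxa hxb ↦ ?_, ?_⟩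
  · exact eq_or_eq_of_mem_support_of_length_le hgirth (e a).2.1 (e b).2.1 (e a).2.2.le
      (e b).2.2.le (fun h ↦ hab (e.injective (Subtype.ext h))) hxa hxb
  · refine (hG.eq_top_of_adj fun x y hxy ↦ ?_).symm
    obtain ⟨p, hp, hxyp⟩ := hadj x y hxy
    rw [Subgraph.iSup_adj]
    refine ⟨e.symm ⟨p, hp⟩, ?_⟩
    simpa [adj_toSubgraph_iff_mem_edges] using hxyp

theorem exists_isPath_isPath_of_length_eq (hc : c.IsCycle) (h : c.length = 2 * ℓ) (i : ℕ) :
    ∃ p q : G.Walk (cycVert c i) (cycVert c (i + ℓ)), (p.IsPath ∧ p.length = ℓ) ∧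
      (q.IsPath ∧ q.length = ℓ) ∧ p ≠ q ∧ ∀ e ∈ c.edges, e ∈ p.edges ∨ e ∈ q.edges := by
  have hm := hc.three_le_length
  have hi : cycVert c i = cycVert c (i + ℓ + ℓ) := by
    rw [Nat.add_assoc, ← Nat.two_mul, ← h, cycVert_add_length]
  obtain ⟨p, hp, hpl, hps, hpe⟩ := exists_isPath_cycVert hc (d := ℓ) (by omega) rfl rfl
  obtain ⟨q, hq, hql, hqs, hqe⟩ := exists_isPath_cycVert hc (d := ℓ) (by omega) rfl hi
  refine ⟨p, q.reverse, ⟨hp, hpl⟩, ⟨hq.reverse, by simpa using hql⟩, ?_, fun e he ↦ ?_⟩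
  · rintro rfl
    obtain ⟨k, hk, h₁⟩ := (hqs (cycVert c (i + 1))).mp (by
      simpa using (hps _).mpr ⟨1, by omega, rfl⟩)
    rcases hk.lt_or_eq with hk | rfl
    · rw [Nat.add_assoc] at h₁
      have := eq_of_cycVert_add_eq hc (by omega) (by omega) h₁
      omega
    · have := eq_of_cycVert_add_eq hc (j := 0) (by omega) (by omega) (h₁.trans hi.symm)
      omega
  · obtain ⟨d, hd, rfl⟩ := exists_eq_mk_cycVert_add he i
    rcases lt_or_ge d ℓ with hdℓ | hdℓ
    · exact .inl ((hpe _).mpr ⟨d, hdℓ, rfl⟩)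
    · refine .inr ?_
      rw [edges_reverse, List.mem_reverse]
      refine (hqe _).mpr ⟨d - ℓ, by omega, ?_⟩
      rw [Nat.add_assoc i ℓ, Nat.add_sub_cancel' hdℓ]

namespace IsBaseCycle

theorem exists_isTheta [Finite V] (hc : IsBaseCycle c ℓ) (hG : IsTwoConnected G)
    (h : c.length = 2 * ℓ) : ∃ r, 2 ≤ r ∧ IsTheta (⊤ : G.Subgraph) r ℓ := by
  have hm := hc.isCycle.three_le_length
  obtain ⟨i, hi⟩ := hc.exists_forall_isEarAt h
  obtain ⟨p, q, hp, hq, hpq, hcpq⟩ := exists_isPath_isPath_of_length_eq hc.isCycle h i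
  refine ⟨_, ?_, hG.isTheta_top hc.two_mul_le_egirth (u := cycVert c i) (v := cycVert c (i + ℓ))
    (fun h₀ ↦ ?_) fun x y hxy ↦ ?_⟩
  · have := finite_subtype_of_isPath (P := fun p : G.Walk (cycVert c i) (cycVert c (i + ℓ)) ↦
      p.IsPath ∧ p.length = ℓ) fun p hp ↦ hp.1
    exact Finite.one_lt_card_iff_nontrivial.mpr ⟨⟨p, hp⟩, ⟨q, hq⟩, by simpa using hpq⟩
  · have := eq_of_cycVert_add_eq hc.isCycle (i := 0) (by omega) (by omega) h₀
    omega
  · by_cases hxyc : c.toSubgraph.Adj x y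
    · rcases hcpq s(x, y) (adj_toSubgraph_iff_mem_edges.mp hxyc) with he | he
      exacts [⟨p, hp, he⟩, ⟨q, hq, he⟩]
    · obtain ⟨j, -, a, b, q, hq, he⟩ := hc.exists_isEarAt_of_adj hG hxy hxyc
      have hql := hc.length_eq_of_isEar hq.toIsEar
      rcases hi j a b q hq with ⟨rfl, rfl⟩ | ⟨rfl, rfl⟩
      · exact ⟨q, ⟨hq.isPath, hql⟩, he⟩
      · exact ⟨q.reverse, ⟨hq.isPath.reverse, by simpa using hql⟩, by simpa using he⟩

theorem isCycleWithThetas [Finite V] (hc : IsBaseCycle c ℓ) (hG : IsTwoConnected G)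
    (hlt : 2 * ℓ < c.length) : IsCycleWithThetas (⊤ : G.Subgraph) c.length ℓ := by
  classical
  let P (i : ℕ) := {p : G.Walk (c.getVert i) (c.getVert ((i + ℓ) % c.length)) // IsEarAt c ℓ i p}
  have (i : ℕ) : Finite (P i) := finite_subtype_of_isPath fun p hp ↦ hp.isPath
  let e (i : ℕ) : Fin (Nat.card (P i)) ≃ P i := (Finite.equivFin (P i)).symm
  let s : Finset ℕ := {i ∈ Finset.range c.length | Nonempty (P i)}
  have hs {i : ℕ} : i ∈ s ↔ i < c.length ∧ Nonempty (P i) := by simp [s]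
  refine ⟨v, c, s, fun i ↦ Nat.card (P i), fun i a ↦ (e i a).1, hc.isCycle, rfl,
    fun i hi ↦ (hs.mp hi).1, fun i hi j hj hij ↦ ?_,
    fun i a ↦ ⟨(e i a).2.isPath, hc.length_eq_of_isEar (e i a).2.toIsEar⟩,
    fun i a x hx hxc ↦ (e i a).2.eq_or_eq x hx ((mem_verts_toSubgraph c).mpr hxc), ?_, ?_⟩
  · obtain ⟨⟨-, ⟨p, hp⟩⟩, ⟨hjm, ⟨q, hq⟩⟩⟩ := And.intro (hs.mp hi) (hs.mp hj)
    exact hc.add_le_and_add_le_of_isEarAt hp hq hij (by omega)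
  · rintro ⟨i, hi⟩ a ⟨j, hj⟩ b hab x hxa hxb
    have him := (hs.mp hi).1
    have hjm := (hs.mp hj).1
    rcases lt_trichotomy i j with hij | rfl | hij
    · exact hc.mem_support_of_isEarAt_of_lt hlt (e i a).2 (e j b).2 hij (by omega) hxa hxb
    · refine hc.mem_support_of_isEarAt (e i a).2 (e i b).2 (fun h ↦ hab ?_) hxa hxb
      rw [(e i).injective (Subtype.ext h)]
    · exact hc.mem_support_of_isEarAt_of_lt hlt (e j b).2 (e i a).2 hij (by omega) hxb hxa
  · refine (hG.eq_top_of_adj fun x y hxy ↦ ?_).symm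
    rw [Subgraph.sup_adj]
    refine or_iff_not_imp_left.mpr fun hxyc ↦ ?_
    obtain ⟨i, hi, a, b, q, hq, he⟩ := hc.exists_isEarAt_of_adj hG hxy hxyc
    obtain rfl := hq.start_eq.trans (cycVert_of_lt hi)
    obtain rfl := hq.end_eq
    simp only [Subgraph.iSup_adj, adj_toSubgraph_iff_mem_edges]
    refine ⟨⟨i, hs.mpr ⟨hi, ⟨q, hq⟩⟩⟩, (e i).symm ⟨q, hq⟩, ?_⟩
    rw [Equiv.apply_symm_apply]
    exact he

end IsBaseCycle

theorem IsTwoConnected.exists_isTheta_top [Finite V] (hG : IsTwoConnected G)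
    (hGL : IsLCycleGraph G {2 * ℓ}) : ∃ r, 2 ≤ r ∧ IsTheta (⊤ : G.Subgraph) r ℓ := by
  obtain ⟨v, c, hc⟩ := hG.exists_isCycle
  have hcl : c.length = 2 * ℓ := hGL v c hc
  exact IsBaseCycle.exists_isTheta ⟨hc, .inl hcl, fun w c' hc' ↦ .inr (hGL w c' hc')⟩ hG hcl

theorem IsTwoConnected.exists_isTheta_top_or_isCycleWithThetas_top [Finite V]
    (hG : IsTwoConnected G) {m : ℕ} (hm : Odd m) (hℓm : 2 * ℓ < m)
    (hGL : IsLCycleGraph G {m, 2 * ℓ}) :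
    (∃ r, 2 ≤ r ∧ IsTheta (⊤ : G.Subgraph) r ℓ) ∨ IsCycleWithThetas (⊤ : G.Subgraph) m ℓ := by
  by_cases h : ∃ (v : V) (c : G.Walk v v), c.IsCycle ∧ c.length = m
  · obtain ⟨v, c, hc, rfl⟩ := h
    exact .inr (IsBaseCycle.isCycleWithThetas ⟨hc, .inr ⟨hm, hℓm⟩, hGL⟩ hG hℓm)
  · exact .inl (hG.exists_isTheta_top fun v c hc ↦
      (hGL v c hc).resolve_left fun hcm ↦ h ⟨v, c, hc, hcm⟩)

end Structure

section Transfer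

open SimpleGraph Walk

variable {V W : Type*} {G : SimpleGraph V} {G' : SimpleGraph W} {f : G →g G'} {H : G.Subgraph}
  {m r ℓ : ℕ}

theorem IsLCycleGraph.comap {L : Set ℕ} (h : IsLCycleGraph G' L) (hf : Function.Injective f) :
    IsLCycleGraph G L := fun v c hc ↦ by
  simpa using h (f v) (c.map f) (hc.map hf)

theorem mem_support_map (hf : Function.Injective f) {u v x : V} {p : G.Walk u v} :
    f x ∈ (p.map f).support ↔ x ∈ p.support := by
  rw [Walk.support_map, List.mem_map_of_injective hf]

theorem toSubgraph_copy {u v u' v' : V} (p : G.Walk u v) (hu : u = u') (hv : v = v') :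
    (p.copy hu hv).toSubgraph = p.toSubgraph := by
  subst hu hv
  rfl

theorem map_iSup_subgraph {ι : Sort*} (f : G →g G') (H : ι → G.Subgraph) :
    (⨆ i, H i).map f = ⨆ i, (H i).map f :=
  (show GaloisConnection (Subgraph.map f) (Subgraph.comap f) from
    Subgraph.map_le_iff_le_comap f).l_iSup

theorem IsCycleOfLength.map (h : IsCycleOfLength H m) (hf : Function.Injective f) :
    IsCycleOfLength (H.map f) m := by
  obtain ⟨v, c, hc, rfl, rfl⟩ := h
  exact ⟨f v, c.map f, hc.map hf, length_map f c, (toSubgraph_map f c).symm⟩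

theorem IsTheta.map (h : IsTheta H r ℓ) (hf : Function.Injective f) :
    IsTheta (H.map f) r ℓ := by
  obtain ⟨u, v, p, huv, hp, hpinj, hpp, rfl⟩ := h
  refine ⟨f u, f v, fun a ↦ (p a).map f, hf.ne huv,
    fun a ↦ ⟨(hp a).1.map hf, (length_map f _).trans (hp a).2⟩,
    (map_injective_of_injective hf u v).comp hpinj, fun a b hab x hxa hxb ↦ ?_, ?_⟩
  · obtain ⟨x, hx, rfl⟩ := List.mem_map.mp (support_map f (p a) ▸ hxa)
    rw [mem_support_map hf] at hxb
    exact (hpp a b hab x hx hxb).imp (congrArg f) (congrArg f)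
  · simp only [map_iSup_subgraph, toSubgraph_map]

theorem IsCycleWithThetas.map (h : IsCycleWithThetas H m ℓ) (hf : Function.Injective f) :
    IsCycleWithThetas (H.map f) m ℓ := by
  obtain ⟨v, c, s, r, p, hc, hcm, hsm, hs, hp, hpc, hpp, rfl⟩ := h
  refine ⟨f v, c.map f, s, r,
    fun i a ↦ ((p i a).map f).copy (c.getVert_map f _).symm (c.getVert_map f _).symm,
    hc.map hf, by simpa using hcm, hsm, hs, fun i a ↦ ?_, fun i a x hx hxc ↦ ?_,
    fun i a j b hab x hxa hxb ↦ ?_, ?_⟩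
  · simpa [isPath_map_iff_of_injective hf] using hp i a
  · obtain ⟨x, hxc', rfl⟩ := List.mem_map.mp (support_map f c ▸ hxc)
    rw [support_copy, mem_support_map hf] at hx
    simpa [getVert_map, hf.eq_iff] using hpc i a x hx hxc'
  · rw [support_copy] at hxa hxb
    obtain ⟨x, hx, rfl⟩ := List.mem_map.mp (support_map f (p i a) ▸ hxa)
    rw [mem_support_map hf] at hxb ⊢
    exact hpp i a j b hab x hx hxb
  · simp only [Subgraph.map_sup, map_iSup_subgraph, toSubgraph_map, toSubgraph_copy]

end Transfer

theorem theorem1_general {V : Type*} {G : SimpleGraph V} {B : G.Subgraph}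
    (hB : IsTwoConnected B.coe) :
    (∀ L : Set ℕ, (∀ m ∈ L, Odd m) → IsLCycleGraph B.coe L → ∃ m ∈ L, IsCycleOfLength B m) ∧
    (∀ k : ℕ, B.verts.Finite → IsLCycleGraph B.coe {2 * k} → ∃ r, 2 ≤ r ∧ IsTheta B r k) ∧
    (∀ k ℓ : ℕ, B.verts.Finite → 2 * ℓ < 2 * k + 1 → IsLCycleGraph B.coe {2 * k + 1, 2 * ℓ} →
      (∃ r, 2 ≤ r ∧ IsTheta B r ℓ) ∨ IsCycleWithThetas B (2 * k + 1) ℓ) := by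
  have hf := B.hom_injective
  have hmap := B.map_hom_top
  refine ⟨fun L hL hBL ↦ ?_, fun k hfin hBL ↦ ?_, fun k ℓ hfin hℓ hBL ↦ ?_⟩
  · obtain ⟨m, hm, hBm⟩ := hB.exists_isCycleOfLength_top hL hBL
    exact ⟨m, hm, hmap ▸ hBm.map hf⟩
  · have := hfin.to_subtype
    obtain ⟨r, hr, hBr⟩ := hB.exists_isTheta_top hBL
    exact ⟨r, hr, hmap ▸ hBr.map hf⟩
  · have := hfin.to_subtype
    rcases hB.exists_isTheta_top_or_isCycleWithThetas_top (odd_two_mul_add_one k) hℓ hBL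
      with ⟨r, hr, hBr⟩ | hBm
    exacts [.inl ⟨r, hr, hmap ▸ hBr.map hf⟩, .inr (hmap ▸ hBm.map hf)]

theorem theorem1 {V : Type*} [Finite V] (G : SimpleGraph V) :
    (∀ L : Set ℕ, (∀ m ∈ L, 3 ≤ m ∧ Odd m) → IsLCycleGraph G L →
      ∀ B : G.Subgraph, IsTwoConnectedBlock B → ∃ m ∈ L, IsCycleOfLength B m) ∧
    (∀ k : ℕ, 2 ≤ k → IsLCycleGraph G {2 * k} →
      ∀ B : G.Subgraph, IsTwoConnectedBlock B → ∃ r, 2 ≤ r ∧ IsTheta B r k) ∧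
    (∀ k ℓ : ℕ, 2 ≤ ℓ → 2 * ℓ < 2 * k + 1 → IsLCycleGraph G {2 * k + 1, 2 * ℓ} →
      ∀ B : G.Subgraph, IsTwoConnectedBlock B →
        (∃ r, 2 ≤ r ∧ IsTheta B r ℓ) ∨ IsCycleWithThetas B (2 * k + 1) ℓ) := by
  have hsub {L : Set ℕ} (hG : IsLCycleGraph G L) (B : G.Subgraph) : IsLCycleGraph B.coe L :=
    hG.comap B.hom_injective
  exact ⟨fun L hL hG B hB ↦ (theorem1_general hB.2).1 L (fun m hm ↦ (hL m hm).2) (hsub hG B),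
    fun k _ hG B hB ↦ (theorem1_general hB.2).2.1 k B.verts.toFinite (hsub hG B),
    fun k ℓ _ hℓ hG B hB ↦ (theorem1_general hB.2).2.2 k ℓ B.verts.toFinite hℓ (hsub hG B)⟩
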